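/- For each integer $n\ge 1$ let $a_0(n),a_1(n)$ be real numbers with $2a_0(n)+a_1(n)=1$, and suppose that $L_1:=\lim_{n\to\infty}a_1(n)$ exists (in $\mathbb R$). Put $a(x,n):=a_1(n)x+a_0(n)$ and $p_{n,k}(x):=\binom nk x^k(1-x)^{n-k}$ for $0\le k\le n$. For $n\ge1$ define $$p_{n,0}^{M,1}(x):=a(x,n)(1-x)^{n-1},\qquad p_{n,n}^{M,1}(x):=a(1-x,n)x^{n-1},$$ $$p_{n,k}^{M,1}(x):=a(x,n)\,p_{n-1,k}(x)+a(1-x,n)\,p_{n-1,k-1}(x)\quad(1\le k\le n-1),$$ and the modified Kantorovich operator $$K_n^{M,1}(f;x):=(n+1)\sum_{k=0}^n p_{n,k}^{M,1}(x)\int_{k/(n+1)}^{(k+1)/(n+1)}f(t)\,dt .$$ Let $\|g\|_\infty:=\sup_{[0,1]}|g|$ and, for $\delta\geq 0$, let $$\omega_1(g;\delta):=\sup\{|g(s)-g(t)| : s,t\in[0,1],\ |s-t|\le\delta\},$$ $$\omega_2(g;\delta):=\sup\{|g(s+h)-2g(s)+g(s-h)| : 0\le h\le\delta,\ s\pm h\in[0,1]\}.$$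 Then for all $f\in C^2[0,1]$, $n\ge1$ and $x\in[0,1]$, writing $X:=x(1-x)$ and $X':=1-2x$, $$\begin{aligned} \Delta_n^K&:=\left|n\left[K_n^{M,1}(f;x)-f(x)\right]-\frac X2 f''(x)-\frac{X'}2(2+L_1)f'(x)\right|\\ &\le \frac{2}{3(n+1)}\left(\frac34\|f'\|_\infty+\|f''\|_\infty\right)+\frac9{32}\left\{\frac{2}{\sqrt{n+1}}\,\omega_1\!\left(f'';\frac1{\sqrt{n+1}}\right)+\omega_2\!\left(f'';\frac1{\sqrt{n+1}}\right)\right\}\\ &\quad+\frac12|L_1-a_1(n)|\,\|f'\|_\infty+\frac12|L_1+1|\left\{\frac1{n+1}\|f'\|_\infty+\frac1{\sqrt{n+1}}\,\omega_1\!\left(f';\frac1{\sqrt{n+1}}\right)+\frac98\,\omega_2\!\left(f';\frac1{\sqrt{n+1}}\right)\right\}. \end{aligned}$$ -/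

import Mathlib

open Set Filter Topology

noncomputable section

namespace KantorovichModified

/-- The derivative of `g` on `[0,1]` (one-sided at the endpoints). -/
def unitDeriv (g : ℝ → ℝ) : ℝ → ℝ :=
  derivWithin g (Icc 0 1)

/-- The uniform norm on `[0,1]`. -/
def supNorm (g : ℝ → ℝ) : ℝ :=
  sSup ((fun x => |g x|) '' Icc 0 1)

/-- The first order modulus of smoothness on `[0,1]`. -/
def omega1 (g : ℝ → ℝ) (δ : ℝ) : ℝ :=
  sSup {r : ℝ | ∃ s ∈ Icc (0 : ℝ) 1, ∃ t ∈ Icc (0 : ℝ) 1, |s - t| ≤ δ ∧ r = |g s - g t|}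

/-- The second order modulus of smoothness on `[0,1]`. -/
def omega2 (g : ℝ → ℝ) (δ : ℝ) : ℝ :=
  sSup {r : ℝ | ∃ s h : ℝ, 0 ≤ h ∧ h ≤ δ ∧ 0 ≤ s - h ∧ s + h ≤ 1 ∧
    r = |g (s + h) - 2 * g s + g (s - h)|}

/-- The Bernstein fundamental function `p_{n,k}(x)`; it vanishes for `n < k`. -/
def fundamental (n k : ℕ) (x : ℝ) : ℝ :=
  (n.choose k : ℝ) * x ^ k * (1 - x) ^ (n - k)

/-- The linear factor `a(x,n) = a₁(n) x + a₀(n)`. -/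
def linFactor (a₀ a₁ : ℕ → ℝ) (n : ℕ) (x : ℝ) : ℝ :=
  a₁ n * x + a₀ n

/-- The perturbed fundamental function `p_{n,k}^{M,1}(x)`, for `n ≥ 1` and `0 ≤ k ≤ n`. -/
def modFundamental (a₀ a₁ : ℕ → ℝ) (n k : ℕ) (x : ℝ) : ℝ :=
  if k = 0 then linFactor a₀ a₁ n x * (1 - x) ^ (n - 1)
  else if k = n then linFactor a₀ a₁ n (1 - x) * x ^ (n - 1)
  else linFactor a₀ a₁ n x * fundamental (n - 1) k x
    + linFactor a₀ a₁ n (1 - x) * fundamental (n - 1) (k - 1) x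

/-- The modified Kantorovich operator `K_n^{M,1}(f;x)`, for `n ≥ 1`. -/
def modKantorovich (a₀ a₁ : ℕ → ℝ) (n : ℕ) (f : ℝ → ℝ) (x : ℝ) : ℝ :=
  ((n : ℝ) + 1) * ∑ k ∈ Finset.range (n + 1), modFundamental a₀ a₁ n k x *
    ∫ t in ((k : ℝ) / ((n : ℝ) + 1))..(((k : ℝ) + 1) / ((n : ℝ) + 1)), f t

/-- The Voronovskaya defect `Δ_n^K`, where `L₁` stands for the limit of `a₁`. -/
def voronovskayaDefect (a₀ a₁ : ℕ → ℝ) (L₁ : ℝ) (n : ℕ) (f : ℝ → ℝ) (x : ℝ) : ℝ :=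
  |(n : ℝ) * (modKantorovich a₀ a₁ n f x - f x)
    - x * (1 - x) / 2 * unitDeriv (unitDeriv f) x
    - (1 - 2 * x) / 2 * (2 + L₁) * unitDeriv f x|

end KantorovichModified

end

/-! Since `2 * a₀ + a₁ = 1`, the factor a(x,n) differs from 1 - x, and a(1-x,n) from x, by opposite
multiples of (a₁ + 1)(1 - 2x)/2. Hence the modified operator is the classical Kantorovich operator K
plus (a₁ + 1)(1 - 2x)/2 times D, a Bernstein sum of differences of neighbouring cell integrals
(`modKantorovich_succ`). It remains to bound the classical Voronovskaya defect of K and to show that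
nD approximates f'; replacing a₁ by L₁ costs only the bound |nD| ≤ ‖f'‖.

Both estimates rest on `exists_parabola`. If g has first and second differences at most v and w at
steps up to η, then g(t) - g(x) ≤ c(t - x) + w(1 + (t - x)²/(2η²)) with |c| ≤ v/η. Such a slope c
exists because every slope forced from the right of x is at most every slope allowed from the left,
which is a bound for the distance below a chord; that bound comes from a minimum argument.

For g = f'', integrating twice gives a quartic majorant of f, to which the positive operator K is
applied. For g = f', integrating once gives a cubic p with p - f increasing, and D respects this
order. Exact central moments then give one-sided bounds, and passing to -f gives the other side. -/

noncomputable section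

namespace KantorovichModified

/-! ### Distance below a chord, from second differences -/

/-- A function vanishing at both ends of an interval whose second differences are at most `w` for
small steps, and nonpositive for one particular step `η`, is bounded below by `-w`. -/
lemma neg_le_of_secondDiff_le {u : ℝ → ℝ} {p q w η : ℝ} (hη : 0 < η)
    (hu : ContinuousOn u (Icc p q)) (hp : u p = 0) (hq : u q = 0)
    (h1 : ∀ s d, 0 ≤ d → d ≤ η → p ≤ s - d → s + d ≤ q → u (s + d) - 2 * u s + u (s - d) ≤ w)
    (h2 : ∀ s, p ≤ s - η → s + η ≤ q → u (s + η) - 2 * u s + u (s - η) ≤ 0)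
    {x : ℝ} (hx : x ∈ Icc p q) : -w ≤ u x := by
  obtain ⟨z, hz, hzmin⟩ := isCompact_Icc.exists_isMinOn ⟨x, hx⟩ hu
  -- Take the leftmost minimiser `y`, so that values further left are strictly larger.
  have hS : IsCompact (Icc p q ∩ u ⁻¹' Iic (u z)) :=
    isCompact_Icc.of_isClosed_subset (hu.preimage_isClosed_of_isClosed isClosed_Icc isClosed_Iic)
      inter_subset_left
  obtain ⟨y, ⟨hy, hyz⟩, hyl⟩ := hS.exists_isLeast ⟨z, hz, le_refl (u z)⟩
  have hmin : ∀ t ∈ Icc p q, u y ≤ u t := fun t ht => le_trans hyz (hzmin ht)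
  refine le_trans ?_ (hmin x hx)
  -- If an endpoint is closer than `η`, use the second difference at `y` reaching it: the value
  -- there is 0 and the opposite one is at least `u y`. Otherwise step `η` fits on both sides, and
  -- its second difference would be positive.
  rcases le_or_gt (y - p) (q - y) with hc | hc
  · rcases lt_or_ge (y - p) η with hd | hd
    · have h := h1 y (y - p) (by linarith [hy.1]) hd.le (by linarith) (by linarith)
      have := hmin (y + (y - p)) ⟨by linarith [hy.1], by linarith⟩
      rw [sub_sub_cancel, hp] at h
      linarith
    · exfalso
      have h := h2 y (by linarith) (by linarith)
      have ha := hmin (y + η) ⟨by linarith [hy.1], by linarith⟩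
      have hb : u y < u (y - η) := by
        by_contra! hcon
        have := hyl ⟨⟨by linarith, by linarith [hy.2]⟩, hcon.trans hyz⟩
        linarith
      linarith
  · rcases lt_or_ge (q - y) η with hd | hd
    · have h := h1 y (q - y) (by linarith [hy.2]) hd.le (by linarith) (by linarith)
      have := hmin (y - (q - y)) ⟨by linarith, by linarith [hy.2]⟩
      rw [add_sub_cancel, hq] at h
      linarith
    · exfalso
      have h := h2 y (by linarith) (by linarith)
      have ha := hmin (y + η) ⟨by linarith [hy.1], by linarith⟩
      have hb : u y < u (y - η) := by
        by_contra! hcon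
        have := hyl ⟨⟨by linarith, by linarith [hy.2]⟩, hcon.trans hyz⟩
        linarith
      linarith

/-- Comparison of a function with its linear interpolant on an interval of arbitrary length. -/
lemma interpolant_sub_le {g : ℝ → ℝ} {p q w η : ℝ} (hη : 0 < η) (hw : 0 ≤ w) (hpq : p < q)
    (hg : ContinuousOn g (Icc p q))
    (h : ∀ s d, 0 ≤ d → d ≤ η → p ≤ s - d → s + d ≤ q → g (s + d) - 2 * g s + g (s - d) ≤ w)
    {x : ℝ} (hx : x ∈ Icc p q) :
    (q - x) / (q - p) * g p + (x - p) / (q - p) * g q - g x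
      ≤ w * (1 + (x - p) * (q - x) / (2 * η ^ 2)) := by
  have hqp : q - p ≠ 0 := by linarith
  -- The subtracted quadratic has second difference w d²/η² at step d, exactly `w` at d = η, which
  -- makes the step-`η` difference nonpositive.
  have key := neg_le_of_secondDiff_le (p := p) (q := q) (w := w) (η := η) (x := x)
    (u := fun t => g t - w / (2 * η ^ 2) * ((t - p) * (t - q))
      - ((q - t) / (q - p) * g p + (t - p) / (q - p) * g q)) hη
    (by fun_prop) (by simp [hqp]) (by simp [hqp])
    (fun s d hd0 hdη hsp hsq => by
      have := h s d hd0 hdη hsp hsq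
      have e : w / (2 * η ^ 2) * (2 * d ^ 2) ≥ 0 := by positivity
      have e2 : ∀ t, (q - t) / (q - p) * g p + (t - p) / (q - p) * g q =
        g p + (t - p) * ((g q - g p) / (q - p)) := fun t => by field_simp; ring
      simp only [e2]
      linarith)
    (fun s hsp hsq => by
      have := h s η hη.le le_rfl hsp hsq
      have e : w / (2 * η ^ 2) * (2 * η ^ 2) = w := by field_simp
      have e2 : ∀ t, (q - t) / (q - p) * g p + (t - p) / (q - p) * g q =
        g p + (t - p) * ((g q - g p) / (q - p)) := fun t => by field_simp; ring
      simp only [e2]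
      linarith) hx
  have e3 : w * (1 + (x - p) * (q - x) / (2 * η ^ 2)) =
    w - w / (2 * η ^ 2) * ((x - p) * (x - q)) := by field_simp; ring
  rw [e3]
  linarith

/-- Comparison of a function with its linear interpolant on a short interval. -/
lemma interpolant_sub_le_of_short {g : ℝ → ℝ} {p q w η : ℝ} (hpq : p < q) (hη : q - p ≤ η)
    (hg : ContinuousOn g (Icc p q))
    (h : ∀ s d, 0 ≤ d → d ≤ η → p ≤ s - d → s + d ≤ q → g (s + d) - 2 * g s + g (s - d) ≤ w)
    {x : ℝ} (hx : x ∈ Icc p q) :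
    (q - x) / (q - p) * g p + (x - p) / (q - p) * g q - g x ≤ w := by
  have hqp : q - p ≠ 0 := by linarith
  have key := neg_le_of_secondDiff_le (p := p) (q := q) (w := w) (η := η) (x := x)
    (u := fun t => g t - ((q - t) / (q - p) * g p + (t - p) / (q - p) * g q)) (by linarith)
    (by fun_prop) (by simp [hqp]) (by simp [hqp])
    (fun s d hd0 hdη hsp hsq => by
      have := h s d hd0 hdη hsp hsq
      have e2 : ∀ t, (q - t) / (q - p) * g p + (t - p) / (q - p) * g q =
        g p + (t - p) * ((g q - g p) / (q - p)) := fun t => by field_simp; ring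
      simp only [e2]
      linarith)
    -- Vacuous: two steps `η` do not fit into an interval of length at most `η`.
    (fun s hsp hsq => by linarith) hx
  linarith

/-! ### Parabolic majorants from moduli of smoothness -/

/-- `g` is continuous on `[0,1]`, oscillates by at most `v` over steps `≤ η`, and has second
differences at most `w` over steps `≤ η`. -/
structure ModulusBound (g : ℝ → ℝ) (η v w : ℝ) : Prop where
  cont : ContinuousOn g (Icc 0 1)
  first : ∀ s ∈ Icc (0 : ℝ) 1, ∀ t ∈ Icc (0 : ℝ) 1, |s - t| ≤ η → |g s - g t| ≤ v
  second : ∀ s d : ℝ, 0 ≤ d → d ≤ η → 0 ≤ s - d → s + d ≤ 1 →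
    |g (s + d) - 2 * g s + g (s - d)| ≤ w

namespace ModulusBound

variable {g : ℝ → ℝ} {η v w : ℝ}

lemma neg (h : ModulusBound g η v w) : ModulusBound (fun t => -g t) η v w where
  cont := h.cont.neg
  first s hs t ht hst := by
    have := h.first s hs t ht hst
    rwa [← abs_neg, show -(-g s - -g t) = g s - g t by ring]
  second s d h0 h1 h2 h3 := by
    have := h.second s d h0 h1 h2 h3
    rwa [← abs_neg, show -(-g (s + d) - 2 * -g s + -g (s - d)) =
      g (s + d) - 2 * g s + g (s - d) by ring]

lemma first_nonneg (h : ModulusBound g η v w) (hη : 0 < η) : 0 ≤ v :=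
  (abs_nonneg _).trans (h.first 0 (by simp) 0 (by simp) (by simpa using hη.le))

lemma second_nonneg (h : ModulusBound g η v w) (hη : 0 < η) : 0 ≤ w :=
  (abs_nonneg _).trans (h.second 0 0 le_rfl hη.le (by simp) (by simp))

/-- Compare with the chord over an interval of length exactly `η`, starting at `x` or ending at `x +
d`; as `η ≤ 1 / 2`, one of the two lies in [0,1]. The chord contributes the `v` term and the
deviation from it contributes `w`. -/
lemma sub_le_of_short (h : ModulusBound g η v w) (hη : 0 < η) (hη2 : η ≤ 1 / 2) {x d : ℝ}
    (hx : 0 ≤ x) (hd : 0 ≤ d) (hdη : d ≤ η) (hxd : x + d ≤ 1) :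
    g (x + d) - g x ≤ d / η * v + w := by
  have hdη0 : 0 ≤ d / η := by positivity
  rcases le_or_gt (x + η) 1 with hc | hc
  · have k := interpolant_sub_le_of_short (g := fun t => -g t) (p := x) (q := x + η) (w := w)
      (η := η) (by linarith) (by linarith)
      (h.neg.cont.mono (Icc_subset_Icc hx hc))
      (fun s e h0 h1 h2 h3 => (abs_le.1 (h.neg.second s e h0 h1 (by linarith) (by linarith))).2)
      (x := x + d) ⟨by linarith, by linarith⟩
    have e := (abs_le.1 (h.first (x + η) ⟨by linarith, hc⟩ x ⟨hx, by linarith⟩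
      (by rw [add_sub_cancel_left, abs_of_pos hη]))).2
    have e1 : (x + η - (x + d)) / (x + η - x) = 1 - d / η := by
      rw [add_sub_cancel_left]; field_simp; ring
    have e2 : (x + d - x) / (x + η - x) = d / η := by
      rw [add_sub_cancel_left, add_sub_cancel_left]
    rw [e1, e2] at k
    have := mul_le_mul_of_nonneg_left e hdη0
    nlinarith
  · have k := interpolant_sub_le_of_short (g := g) (p := x + d - η) (q := x + d) (w := w)
      (η := η) (by linarith) (by linarith)
      (h.cont.mono (Icc_subset_Icc (by linarith) hxd))
      (fun s e h0 h1 h2 h3 => (abs_le.1 (h.second s e h0 h1 (by linarith) (by linarith))).2)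
      (x := x) ⟨by linarith, by linarith⟩
    have e := (abs_le.1 (h.first (x + d) ⟨by linarith, hxd⟩ (x + d - η)
      ⟨by linarith, by linarith⟩ (by rw [sub_sub_cancel, abs_of_pos hη]))).2
    have e1 : (x - (x + d - η)) / (x + d - (x + d - η)) = 1 - d / η := by
      rw [sub_sub_cancel]; field_simp; ring
    have e2 : (x + d - x) / (x + d - (x + d - η)) = d / η := by
      rw [sub_sub_cancel, add_sub_cancel_left]
    rw [e1, e2] at k
    have := mul_le_mul_of_nonneg_left e hdη0
    nlinarith

/-- Each full step `η` peeled off costs one `v`; the error `w` is paid only once, on the last short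
piece. -/
lemma sub_le_of_le (h : ModulusBound g η v w) (hη : 0 < η) (hη2 : η ≤ 1 / 2) (k : ℕ) :
    ∀ {x d : ℝ}, 0 ≤ x → 0 ≤ d → d ≤ (k + 1) * η → x + d ≤ 1 →
      g (x + d) - g x ≤ d / η * v + w := by
  induction k with
  | zero =>
    intro x d hx hd hk hxd
    exact h.sub_le_of_short hη hη2 hx hd (by simpa using hk) hxd
  | succ k ih =>
    intro x d hx hd hk hxd
    rcases le_or_gt d η with hc | hc
    · exact h.sub_le_of_short hη hη2 hx hd hc hxd
    · have i := ih hx (d := d - η) (by linarith) (by push_cast at hk; linarith) (by linarith)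
      have e := (abs_le.1 (h.first (x + d) ⟨by linarith, hxd⟩ (x + (d - η))
        ⟨by linarith, by linarith⟩ (by
          rw [show x + d - (x + (d - η)) = η by ring, abs_of_pos hη]))).2
      have e1 : (d - η) / η * v = d / η * v - v := by field_simp
      rw [e1] at i
      linarith

lemma sub_le (h : ModulusBound g η v w) (hη : 0 < η) (hη2 : η ≤ 1 / 2) {x y : ℝ}
    (hx : 0 ≤ x) (hxy : x ≤ y) (hy : y ≤ 1) : g y - g x ≤ (y - x) / η * v + w := by
  obtain ⟨k, hk⟩ := exists_nat_ge ((y - x) / η)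
  have := h.sub_le_of_le hη hη2 k (x := x) (d := y - x) hx (by linarith)
    (by rw [div_le_iff₀ hη] at hk; linarith) (by linarith)
  rwa [add_sub_cancel] at this

/-- A function is dominated near each of its points by a parabola whose linear part is controlled
by the first and whose other coefficients are controlled by the second modulus of smoothness. -/
theorem exists_parabola (h : ModulusBound g η v w) (hη : 0 < η) (hη2 : η ≤ 1 / 2) {x : ℝ}
    (hx : x ∈ Icc (0 : ℝ) 1) :
    ∃ c : ℝ, |c| ≤ v / η ∧ ∀ t ∈ Icc (0 : ℝ) 1,
      g t - g x ≤ c * (t - x) + w * (1 + (t - x) ^ 2 / (2 * η ^ 2)) := by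
  have hv := h.first_nonneg hη
  have hw := h.second_nonneg hη
  have hvη : 0 ≤ v / η := by positivity
  set H : ℝ → ℝ := fun t => w * (1 + (t - x) ^ 2 / (2 * η ^ 2)) with hH
  have hHw : ∀ t, w ≤ H t := fun t => by
    have : 0 ≤ (t - x) ^ 2 / (2 * η ^ 2) := by positivity
    simp only [hH]; nlinarith
  -- Slopes forced by points to the right of `x`. Inserting `-(v / η)` gives the lower bound on the
  -- supremum and keeps the set nonempty when `x = 1`.
  set S : Set ℝ := insert (-(v / η)) ((fun t => (g t - g x - H t) / (t - x)) '' Ioc x 1) with hS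
  have hup : ∀ r ∈ S, r ≤ v / η := by
    rintro r (rfl | ⟨t, ht, rfl⟩)
    · linarith
    · have h0 : 0 < t - x := by linarith [ht.1]
      change (g t - g x - H t) / (t - x) ≤ v / η
      rw [div_le_iff₀ h0]
      have := h.sub_le hη hη2 hx.1 ht.1.le ht.2
      have := hHw t
      have e : v / η * (t - x) = (t - x) / η * v := by ring
      linarith
  have hlow : ∀ t ∈ Ico 0 x, ∀ r ∈ S, r ≤ (g x - g t + H t) / (x - t) := by
    rintro t ht r (rfl | ⟨s, hs, rfl⟩)
    · have h0 : 0 < x - t := by linarith [ht.2]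
      rw [le_div_iff₀ h0]
      have := h.neg.sub_le hη hη2 ht.1 ht.2.le hx.2
      have := hHw t
      have e : v / η * (x - t) = (x - t) / η * v := by ring
      linarith
    · have h0 : 0 < x - t := by linarith [ht.2]
      have h1 : 0 < s - x := by linarith [hs.1]
      have h2 : 0 < s - t := by linarith
      change (g s - g x - H s) / (s - x) ≤ (g x - g t + H t) / (x - t)
      rw [div_le_div_iff₀ h1 h0]
      have k := interpolant_sub_le (g := g) (p := t) (q := s) (w := w)
        (η := η) hη hw (by linarith)
        (h.cont.mono (Icc_subset_Icc ht.1 hs.2))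
        (fun a e h0 h1 h2 h3 => (abs_le.1 (h.second a e h0 h1 (by linarith [ht.1])
          (by linarith [hs.2]))).2)
        (x := x) ⟨by linarith, by linarith⟩
      have k2 := mul_le_mul_of_nonneg_left k h2.le
      have e1 : (s - t) * ((s - x) / (s - t) * g t + (x - t) / (s - t) * g s - g x) =
        (s - x) * g t + (x - t) * g s - (s - t) * g x := by field_simp
      rw [e1] at k2
      -- The chord error splits exactly into the two parabola values, because (x-t)(s-x)² +
      -- (s-x)(x-t)² = (x-t)(s-x)(s-t).
      have e2 : (s - t) * (w * (1 + (x - t) * (s - x) / (2 * η ^ 2))) =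
          (x - t) * H s + (s - x) * H t := by
        simp only [hH]; ring
      rw [e2] at k2
      linarith
  have hbdd : BddAbove S := ⟨v / η, hup⟩
  have hne : S.Nonempty := ⟨_, mem_insert _ _⟩
  refine ⟨sSup S, abs_le.2 ⟨le_csSup hbdd (mem_insert _ _), csSup_le hne hup⟩, fun t ht => ?_⟩
  rcases lt_trichotomy t x with hc | hc | hc
  · have h0 : 0 < x - t := by linarith
    have := csSup_le hne (hlow t ⟨ht.1, hc⟩)
    rw [le_div_iff₀ h0] at this
    change _ ≤ _ + H t
    linarith
  · subst hc
    simpa using hw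
  · have h0 : 0 < t - x := by linarith
    have : (g t - g x - H t) / (t - x) ≤ sSup S :=
      le_csSup hbdd (mem_insert_of_mem _ ⟨t, ⟨hc, ht.2⟩, rfl⟩)
    rw [div_le_iff₀ h0] at this
    change _ ≤ _ + H t
    linarith

end ModulusBound

/-! ### Bernstein sums and binomial moments -/

/-- The Bernstein sum of a function of the index. -/
def bernsteinSum (n : ℕ) (φ : ℕ → ℝ) (x : ℝ) : ℝ :=
  ∑ k ∈ Finset.range (n + 1), fundamental n k x * φ k

lemma fundamental_eq_zero {n k : ℕ} (h : n < k) (x : ℝ) : fundamental n k x = 0 := by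
  simp [fundamental, Nat.choose_eq_zero_of_lt h]

lemma fundamental_nonneg {x : ℝ} (hx : x ∈ Icc (0 : ℝ) 1) (n k : ℕ) : 0 ≤ fundamental n k x := by
  have h0 := hx.1
  have h1 : 0 ≤ 1 - x := by linarith [hx.2]
  unfold fundamental
  positivity

lemma fundamental_succ_zero (n : ℕ) (x : ℝ) :
    fundamental (n + 1) 0 x = (1 - x) * fundamental n 0 x := by
  simp [fundamental, pow_succ']

lemma fundamental_succ_succ (n k : ℕ) (x : ℝ) :
    fundamental (n + 1) (k + 1) x = (1 - x) * fundamental n (k + 1) x + x * fundamental n k x := by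
  unfold fundamental
  rw [Nat.choose_succ_succ, Nat.add_sub_add_right]
  rcases Nat.lt_or_ge k n with h | h
  · have e : n - k = n - (k + 1) + 1 := by omega
    rw [e]
    push_cast
    ring
  · have : n.choose (k + 1) = 0 := Nat.choose_eq_zero_of_lt (by omega)
    rw [this]
    push_cast
    ring

/-- Summation by parts for any Pascal-type kernel: the index shift moves from the kernel to `φ`. It
serves both the ordinary recursion and the modified one. -/
lemma sum_pascal (n : ℕ) (a b x : ℝ) (φ : ℕ → ℝ) (P : ℕ → ℝ) (h0 : P 0 = a * fundamental n 0 x)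
    (hs : ∀ k ≤ n, P (k + 1) = a * fundamental n (k + 1) x + b * fundamental n k x) :
    ∑ k ∈ Finset.range (n + 2), P k * φ k =
      bernsteinSum n (fun k => a * φ k + b * φ (k + 1)) x := by
  have e1 : ∑ k ∈ Finset.range (n + 1), P (k + 1) * φ (k + 1) =
      a * ∑ k ∈ Finset.range (n + 1), fundamental n (k + 1) x * φ (k + 1)
        + ∑ k ∈ Finset.range (n + 1), fundamental n k x * (b * φ (k + 1)) := by
    rw [Finset.mul_sum, ← Finset.sum_add_distrib]
    refine Finset.sum_congr rfl fun k hk => ?_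
    rw [hs k (by simpa [Nat.lt_succ_iff] using hk)]
    ring
  have e2 : a * fundamental n 0 x * φ 0
      + a * ∑ k ∈ Finset.range (n + 1), fundamental n (k + 1) x * φ (k + 1) =
      ∑ k ∈ Finset.range (n + 1), fundamental n k x * (a * φ k) := by
    rw [Finset.sum_range_succ, fundamental_eq_zero n.lt_succ_self, zero_mul, add_zero,
      Finset.sum_range_succ', Finset.mul_sum, add_comm]
    congr 1
    · exact Finset.sum_congr rfl fun k _ => by ring
    · ring
  rw [Finset.sum_range_succ', e1, h0, bernsteinSum]
  simp only [mul_add, Finset.sum_add_distrib]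
  linarith

lemma bernsteinSum_succ (n : ℕ) (φ : ℕ → ℝ) (x : ℝ) :
    bernsteinSum (n + 1) φ x = bernsteinSum n (fun k => (1 - x) * φ k + x * φ (k + 1)) x :=
  sum_pascal n (1 - x) x x φ (fun k => fundamental (n + 1) k x) (fundamental_succ_zero n x)
    fun k _ => fundamental_succ_succ n k x

lemma bernsteinSum_add (n : ℕ) (φ ψ : ℕ → ℝ) (x : ℝ) :
    bernsteinSum n (fun k => φ k + ψ k) x = bernsteinSum n φ x + bernsteinSum n ψ x := by
  simp [bernsteinSum, mul_add, Finset.sum_add_distrib]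

lemma bernsteinSum_const_mul (n : ℕ) (c : ℝ) (φ : ℕ → ℝ) (x : ℝ) :
    bernsteinSum n (fun k => c * φ k) x = c * bernsteinSum n φ x := by
  simp only [bernsteinSum, Finset.mul_sum]
  exact Finset.sum_congr rfl fun k _ => by ring

lemma bernsteinSum_mono {n : ℕ} {φ ψ : ℕ → ℝ} {x : ℝ} (hx : x ∈ Icc (0 : ℝ) 1)
    (h : ∀ k ≤ n, φ k ≤ ψ k) : bernsteinSum n φ x ≤ bernsteinSum n ψ x :=
  Finset.sum_le_sum fun k hk => mul_le_mul_of_nonneg_left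
    (h k (by simpa [Nat.lt_succ_iff] using hk)) (fundamental_nonneg hx n k)

/-- The raw moments of the binomial distribution up to order four. -/
lemma bernsteinSum_quartic (n : ℕ) (x b₀ b₁ b₂ b₃ b₄ : ℝ) :
    bernsteinSum n (fun k => b₀ + b₁ * k + b₂ * (k : ℝ) ^ 2 + b₃ * (k : ℝ) ^ 3 + b₄ * (k : ℝ) ^ 4) x
      = b₀ + b₁ * (n * x) + b₂ * (n * x + n * (n - 1) * x ^ 2)
        + b₃ * (n * x + 3 * n * (n - 1) * x ^ 2 + n * (n - 1) * (n - 2) * x ^ 3)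
        + b₄ * (n * x + 7 * n * (n - 1) * x ^ 2 + 6 * n * (n - 1) * (n - 2) * x ^ 3
          + n * (n - 1) * (n - 2) * (n - 3) * x ^ 4) := by
  induction n generalizing b₀ b₁ b₂ b₃ b₄ with
  | zero => simp [bernsteinSum, fundamental]
  | succ n ih =>
    rw [bernsteinSum_succ]
    -- Lowering the degree replaces `φ` by (1-x)φ(k) + xφ(k+1), again a quartic in k; hence the
    -- induction over all coefficients.
    have e : (fun k : ℕ => (1 - x) * (b₀ + b₁ * (k : ℝ) + b₂ * (k : ℝ) ^ 2 + b₃ * (k : ℝ) ^ 3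
          + b₄ * (k : ℝ) ^ 4)
        + x * (b₀ + b₁ * ((k + 1 : ℕ) : ℝ) + b₂ * ((k + 1 : ℕ) : ℝ) ^ 2 + b₃ * ((k + 1 : ℕ) : ℝ) ^ 3
          + b₄ * ((k + 1 : ℕ) : ℝ) ^ 4)) =
        fun k : ℕ => (b₀ + x * (b₁ + b₂ + b₃ + b₄)) + (b₁ + x * (2 * b₂ + 3 * b₃ + 4 * b₄)) * (k : ℝ)
          + (b₂ + x * (3 * b₃ + 6 * b₄)) * (k : ℝ) ^ 2 + (b₃ + x * (4 * b₄)) * (k : ℝ) ^ 3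
          + b₄ * (k : ℝ) ^ 4 := by
      funext k
      push_cast
      ring
    rw [e, ih]
    push_cast
    ring

/-! ### Kantorovich operators, decomposition and monotonicity -/

/-- The integral of `f` over the `k`-th cell of the Kantorovich grid. -/
def cellIntegral (n : ℕ) (f : ℝ → ℝ) (k : ℕ) : ℝ :=
  ∫ t in ((k : ℝ) / ((n : ℝ) + 1))..(((k : ℝ) + 1) / ((n : ℝ) + 1)), f t

/-- The classical Kantorovich operator. -/
def kantorovich (n : ℕ) (f : ℝ → ℝ) (x : ℝ) : ℝ :=
  ((n : ℝ) + 1) * bernsteinSum n (cellIntegral n f) x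

/-- The Bernstein sum of the differences of consecutive cell integrals. -/
def kantorovichDiff (m : ℕ) (f : ℝ → ℝ) (x : ℝ) : ℝ :=
  ((m : ℝ) + 2) *
    bernsteinSum m (fun k => cellIntegral (m + 1) f (k + 1) - cellIntegral (m + 1) f k) x

/-- Written over degree `m`, both operators have weights on two neighbouring cells, and these
weights differ by opposite amounts. -/
lemma modKantorovich_succ (a₀ a₁ : ℕ → ℝ) (m : ℕ) (f : ℝ → ℝ) (x : ℝ)
    (ha : 2 * a₀ (m + 1) + a₁ (m + 1) = 1) :
    modKantorovich a₀ a₁ (m + 1) f x = kantorovich (m + 1) f x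
      + (a₁ (m + 1) + 1) * (1 - 2 * x) / 2 * kantorovichDiff m f x := by
  have h1 : ∑ k ∈ Finset.range (m + 2), modFundamental a₀ a₁ (m + 1) k x * cellIntegral (m + 1) f k
      = bernsteinSum m (fun k => linFactor a₀ a₁ (m + 1) x * cellIntegral (m + 1) f k
        + linFactor a₀ a₁ (m + 1) (1 - x) * cellIntegral (m + 1) f (k + 1)) x := by
    refine sum_pascal m _ _ x _ (fun k => modFundamental a₀ a₁ (m + 1) k x) ?_ fun k hk => ?_
    · simp [modFundamental, fundamental]
    · rcases hk.eq_or_lt with rfl | hk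
      · simp [modFundamental, fundamental]
      · simp [modFundamental, hk.ne]
  have h2 : a₀ (m + 1) = (1 - a₁ (m + 1)) / 2 := by linarith
  have h3 : modKantorovich a₀ a₁ (m + 1) f x = ((m : ℝ) + 2) *
      ∑ k ∈ Finset.range (m + 2), modFundamental a₀ a₁ (m + 1) k x * cellIntegral (m + 1) f k := by
    unfold modKantorovich cellIntegral
    push_cast
    ring
  rw [h3, h1, kantorovich, kantorovichDiff, bernsteinSum_succ]
  have h4 : (fun k => linFactor a₀ a₁ (m + 1) x * cellIntegral (m + 1) f k
        + linFactor a₀ a₁ (m + 1) (1 - x) * cellIntegral (m + 1) f (k + 1)) =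
      fun k => ((1 - x) * cellIntegral (m + 1) f k + x * cellIntegral (m + 1) f (k + 1))
        + (a₁ (m + 1) + 1) * (1 - 2 * x) / 2 *
          (cellIntegral (m + 1) f (k + 1) - cellIntegral (m + 1) f k) := by
    funext k
    simp only [linFactor, h2]
    ring
  rw [h4, bernsteinSum_add, bernsteinSum_const_mul]
  push_cast
  ring

lemma cell_subset {n k : ℕ} (hk : k ≤ n) :
    Icc ((k : ℝ) / ((n : ℝ) + 1)) (((k : ℝ) + 1) / ((n : ℝ) + 1)) ⊆ Icc 0 1 := by
  have h : (k : ℝ) ≤ n := by exact_mod_cast hk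
  refine Icc_subset_Icc (by positivity) ?_
  rw [div_le_one (by positivity)]
  linarith

lemma cell_le (n k : ℕ) : (k : ℝ) / ((n : ℝ) + 1) ≤ ((k : ℝ) + 1) / ((n : ℝ) + 1) := by
  gcongr
  linarith

lemma intervalIntegrable_cell {f : ℝ → ℝ} (hf : ContinuousOn f (Icc 0 1)) {n k : ℕ} (hk : k ≤ n) :
    IntervalIntegrable f MeasureTheory.volume
      ((k : ℝ) / ((n : ℝ) + 1)) (((k : ℝ) + 1) / ((n : ℝ) + 1)) :=
  ContinuousOn.intervalIntegrable (by
    rw [uIcc_of_le (cell_le n k)]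
    exact hf.mono (cell_subset hk))

lemma cellIntegral_mono {f g : ℝ → ℝ} (hf : ContinuousOn f (Icc 0 1))
    (hg : ContinuousOn g (Icc 0 1)) (h : ∀ t ∈ Icc (0 : ℝ) 1, f t ≤ g t) {n k : ℕ} (hk : k ≤ n) :
    cellIntegral n f k ≤ cellIntegral n g k :=
  intervalIntegral.integral_mono_on (cell_le n k) (intervalIntegrable_cell hf hk)
    (intervalIntegrable_cell hg hk) fun t ht => h t (cell_subset hk ht)

lemma cellIntegral_neg (n : ℕ) (f : ℝ → ℝ) (k : ℕ) :
    cellIntegral n (fun t => -f t) k = -cellIntegral n f k :=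
  intervalIntegral.integral_neg

lemma cellIntegral_const (n : ℕ) (c : ℝ) (k : ℕ) :
    cellIntegral n (fun _ => c) k = c / ((n : ℝ) + 1) := by
  rw [cellIntegral, intervalIntegral.integral_const, smul_eq_mul]
  ring

/-- Monotone functions have monotone cell integrals. -/
lemma cellIntegral_le_succ {h : ℝ → ℝ} (hc : ContinuousOn h (Icc 0 1))
    (hm : MonotoneOn h (Icc 0 1)) {n k : ℕ} (hk : k + 1 ≤ n) :
    cellIntegral n h k ≤ cellIntegral n h (k + 1) := by
  -- The common endpoint of the two cells: the value there separates the two integrals.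
  set c : ℝ := ((k : ℝ) + 1) / ((n : ℝ) + 1) with hcdef
  have hcI : c ∈ Icc (0 : ℝ) 1 := cell_subset (by omega) ⟨cell_le n k, le_rfl⟩
  calc cellIntegral n h k ≤ cellIntegral n (fun _ => h c) k :=
        intervalIntegral.integral_mono_on (cell_le n k) (intervalIntegrable_cell hc (by omega))
          (by simp) fun t ht => hm (cell_subset (by omega) ht) hcI ht.2
    _ = cellIntegral n (fun _ => h c) (k + 1) := by rw [cellIntegral_const, cellIntegral_const]
    _ ≤ cellIntegral n h (k + 1) :=
        intervalIntegral.integral_mono_on (cell_le n (k + 1)) (by simp)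
          (intervalIntegrable_cell hc hk) fun t ht => hm hcI (cell_subset hk ht)
            (by simpa [hcdef] using ht.1)

lemma kantorovich_mono {f g : ℝ → ℝ} (hf : ContinuousOn f (Icc 0 1))
    (hg : ContinuousOn g (Icc 0 1)) (h : ∀ t ∈ Icc (0 : ℝ) 1, f t ≤ g t) (n : ℕ) {x : ℝ}
    (hx : x ∈ Icc (0 : ℝ) 1) : kantorovich n f x ≤ kantorovich n g x :=
  mul_le_mul_of_nonneg_left (bernsteinSum_mono hx fun _ hk => cellIntegral_mono hf hg h hk)
    (by positivity)

/-- Differences of cell integrals are nonnegative for an increasing function, so the order respected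
here is monotonicity of the difference rather than pointwise inequality. -/
lemma kantorovichDiff_mono {f g : ℝ → ℝ} (hf : ContinuousOn f (Icc 0 1))
    (hg : ContinuousOn g (Icc 0 1)) (h : MonotoneOn (fun t => g t - f t) (Icc 0 1)) (m : ℕ) {x : ℝ}
    (hx : x ∈ Icc (0 : ℝ) 1) : kantorovichDiff m f x ≤ kantorovichDiff m g x := by
  refine mul_le_mul_of_nonneg_left (bernsteinSum_mono hx fun k hk => ?_) (by positivity)
  have e : ∀ j ≤ m + 1, cellIntegral (m + 1) (fun t => g t - f t) j =
      cellIntegral (m + 1) g j - cellIntegral (m + 1) f j := fun j hj =>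
    intervalIntegral.integral_sub (intervalIntegrable_cell hg hj) (intervalIntegrable_cell hf hj)
  have := cellIntegral_le_succ (h := fun t => g t - f t) (hg.sub hf) h (n := m + 1) (k := k) (by omega)
  rw [e k (by omega), e (k + 1) (by omega)] at this
  linarith

lemma kantorovich_neg (n : ℕ) (f : ℝ → ℝ) (x : ℝ) :
    kantorovich n (fun t => -f t) x = -kantorovich n f x := by
  simp [kantorovich, bernsteinSum, cellIntegral_neg]

lemma kantorovichDiff_neg (m : ℕ) (f : ℝ → ℝ) (x : ℝ) :
    kantorovichDiff m (fun t => -f t) x = -kantorovichDiff m f x := by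
  have e : (fun k => cellIntegral (m + 1) (fun t => -f t) (k + 1)
      - cellIntegral (m + 1) (fun t => -f t) k) = fun k =>
      (-1) * (cellIntegral (m + 1) f (k + 1) - cellIntegral (m + 1) f k) := by
    funext k
    rw [cellIntegral_neg, cellIntegral_neg]
    ring
  rw [kantorovichDiff, e, bernsteinSum_const_mul, kantorovichDiff]
  ring

/-! ### Central moments -/

lemma cellIntegral_quartic (n k : ℕ) (x c₀ c₁ c₂ c₃ c₄ : ℝ) :
    cellIntegral n (fun t => c₀ + c₁ * (t - x) + c₂ * (t - x) ^ 2 + c₃ * (t - x) ^ 3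
      + c₄ * (t - x) ^ 4) k =
    (c₀ + c₁ * (((k : ℝ) + 1 / 2) / (n + 1) - x)
      + c₂ * (((k : ℝ) ^ 2 + k + 1 / 3) / (n + 1) ^ 2 - 2 * x * ((k : ℝ) + 1 / 2) / (n + 1) + x ^ 2)
      + c₃ * (((k : ℝ) ^ 3 + 3 / 2 * k ^ 2 + k + 1 / 4) / (n + 1) ^ 3
        - 3 * x * ((k : ℝ) ^ 2 + k + 1 / 3) / (n + 1) ^ 2
        + 3 * x ^ 2 * ((k : ℝ) + 1 / 2) / (n + 1) - x ^ 3)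
      + c₄ * (((k : ℝ) ^ 4 + 2 * k ^ 3 + 2 * k ^ 2 + k + 1 / 5) / (n + 1) ^ 4
        - 4 * x * ((k : ℝ) ^ 3 + 3 / 2 * k ^ 2 + k + 1 / 4) / (n + 1) ^ 3
        + 6 * x ^ 2 * ((k : ℝ) ^ 2 + k + 1 / 3) / (n + 1) ^ 2
        - 4 * x ^ 3 * ((k : ℝ) + 1 / 2) / (n + 1) + x ^ 4)) / (n + 1) := by
  have hN : (n : ℝ) + 1 ≠ 0 := by positivity
  have hd : ∀ t : ℝ, HasDerivAt (fun t => c₀ * (t - x) + c₁ / 2 * (t - x) ^ 2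
      + c₂ / 3 * (t - x) ^ 3 + c₃ / 4 * (t - x) ^ 4 + c₄ / 5 * (t - x) ^ 5)
      (c₀ + c₁ * (t - x) + c₂ * (t - x) ^ 2 + c₃ * (t - x) ^ 3 + c₄ * (t - x) ^ 4) t := by
    intro t
    have hy := (hasDerivAt_id' t).sub_const x
    refine (((((hy.const_mul c₀).add ((hy.pow 2).const_mul (c₁ / 2))).add
      ((hy.pow 3).const_mul (c₂ / 3))).add ((hy.pow 4).const_mul (c₃ / 4))).add
      ((hy.pow 5).const_mul (c₄ / 5))).congr_deriv ?_
    push_cast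
    ring
  rw [cellIntegral, intervalIntegral.integral_eq_sub_of_hasDerivAt (fun t _ => hd t)
    (Continuous.intervalIntegrable (by fun_prop) _ _)]
  generalize (n : ℝ) + 1 = N at *
  field_simp
  ring

/-- The central moments of the Kantorovich operator up to order four. -/
lemma kantorovich_quartic (n : ℕ) (x c₀ c₁ c₂ c₃ c₄ : ℝ) :
    kantorovich n (fun t => c₀ + c₁ * (t - x) + c₂ * (t - x) ^ 2 + c₃ * (t - x) ^ 3
      + c₄ * (t - x) ^ 4) x =
    c₀ + c₁ * ((1 - 2 * x) / 2 / (n + 1))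
      + c₂ * (((n - 1) * (x * (1 - x)) + 1 / 3) / (n + 1) ^ 2)
      + c₃ * ((1 - 2 * x) * (5 / 2 * n * (x * (1 - x)) + (1 - 2 * (x * (1 - x))) / 4)
        / (n + 1) ^ 3)
      + c₄ * ((3 * n ^ 2 * (x * (1 - x)) ^ 2 + n * (x * (1 - x)) * (5 - 20 * (x * (1 - x)))
        + 1 / 5 - x * (1 - x) + (x * (1 - x)) ^ 2) / (n + 1) ^ 4) := by
  have hN : (n : ℝ) + 1 ≠ 0 := by positivity
  set N : ℝ := n + 1 with hNdef
  have e : cellIntegral n (fun t => c₀ + c₁ * (t - x) + c₂ * (t - x) ^ 2 + c₃ * (t - x) ^ 3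
      + c₄ * (t - x) ^ 4) = fun k : ℕ => (1 / N) * (
        (c₀ + c₁ * (1 / 2 / N - x) + c₂ * (1 / 3 / N ^ 2 - x / N + x ^ 2)
          + c₃ * (1 / 4 / N ^ 3 - x / N ^ 2 + 3 / 2 * x ^ 2 / N - x ^ 3)
          + c₄ * (1 / 5 / N ^ 4 - x / N ^ 3 + 2 * x ^ 2 / N ^ 2 - 2 * x ^ 3 / N + x ^ 4))
        + (c₁ / N + c₂ * (1 / N ^ 2 - 2 * x / N)
          + c₃ * (1 / N ^ 3 - 3 * x / N ^ 2 + 3 * x ^ 2 / N)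
          + c₄ * (1 / N ^ 4 - 4 * x / N ^ 3 + 6 * x ^ 2 / N ^ 2 - 4 * x ^ 3 / N)) * (k : ℝ)
        + (c₂ / N ^ 2 + c₃ * (3 / 2 / N ^ 3 - 3 * x / N ^ 2)
          + c₄ * (2 / N ^ 4 - 6 * x / N ^ 3 + 6 * x ^ 2 / N ^ 2)) * (k : ℝ) ^ 2
        + (c₃ / N ^ 3 + c₄ * (2 / N ^ 4 - 4 * x / N ^ 3)) * (k : ℝ) ^ 3
        + c₄ / N ^ 4 * (k : ℝ) ^ 4) := by
    funext k
    rw [cellIntegral_quartic, ← hNdef]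
    field_simp
    ring
  rw [kantorovich, e, bernsteinSum_const_mul, bernsteinSum_quartic, ← hNdef]
  have hn : (n : ℝ) = N - 1 := by rw [hNdef]; ring
  rw [hn]
  field_simp
  ring

lemma kantorovichDiff_cubic (m : ℕ) (x c₁ c₂ c₃ : ℝ) :
    kantorovichDiff m (fun t => c₁ * (t - x) + c₂ * (t - x) ^ 2 + c₃ * (t - x) ^ 3) x =
    c₁ / (m + 2) + c₂ * (2 * (1 - 2 * x) / (m + 2) ^ 2)
      + c₃ * ((3 * (m - 4) * (x * (1 - x)) + 7 / 2) / (m + 2) ^ 3) := by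
  have hN : (m : ℝ) + 2 ≠ 0 := by positivity
  set N : ℝ := m + 2 with hNdef
  have e : (fun k => cellIntegral (m + 1) (fun t => c₁ * (t - x) + c₂ * (t - x) ^ 2
      + c₃ * (t - x) ^ 3) (k + 1) - cellIntegral (m + 1) (fun t => c₁ * (t - x) + c₂ * (t - x) ^ 2
      + c₃ * (t - x) ^ 3) k) = fun k : ℕ => (1 / N) * (
        (c₁ / N + c₂ * (2 / N ^ 2 - 2 * x / N) + c₃ * (7 / 2 / N ^ 3 - 6 * x / N ^ 2
          + 3 * x ^ 2 / N)) + (c₂ * (2 / N ^ 2) + c₃ * (6 / N ^ 3 - 6 * x / N ^ 2)) * (k : ℝ)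
        + c₃ * (3 / N ^ 3) * (k : ℝ) ^ 2 + 0 * (k : ℝ) ^ 3 + 0 * (k : ℝ) ^ 4) := by
    funext k
    have e1 : (fun t => c₁ * (t - x) + c₂ * (t - x) ^ 2 + c₃ * (t - x) ^ 3) = fun t =>
        0 + c₁ * (t - x) + c₂ * (t - x) ^ 2 + c₃ * (t - x) ^ 3 + 0 * (t - x) ^ 4 := by
      funext t
      ring
    have e2 : ((m + 1 : ℕ) : ℝ) + 1 = N := by rw [hNdef]; push_cast; ring
    rw [e1, cellIntegral_quartic, cellIntegral_quartic, e2]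
    push_cast
    field_simp
    ring
  rw [kantorovichDiff, e, bernsteinSum_const_mul, bernsteinSum_quartic, ← hNdef]
  have hn : (m : ℝ) = N - 2 := by rw [hNdef]; ring
  rw [hn]
  field_simp
  ring

/-! ### From derivative bounds to operator bounds -/

lemma monotoneOn_of_hasDerivWithinAt {φ φ' : ℝ → ℝ} {a b : ℝ}
    (hφ : ∀ t ∈ Icc (0 : ℝ) 1, HasDerivWithinAt φ (φ' t) (Icc 0 1) t) (hab : Icc a b ⊆ Icc 0 1)
    (h : ∀ t ∈ Icc a b, 0 ≤ φ' t) : MonotoneOn φ (Icc a b) :=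
  monotoneOn_of_hasDerivWithinAt_nonneg (f' := φ') (convex_Icc a b)
    (fun t ht => ((hφ t (hab ht)).mono hab).continuousWithinAt)
    (fun t ht => (hφ t (hab (interior_subset ht))).mono (interior_subset.trans hab))
    fun t ht => h t (interior_subset ht)

/-- A function with nonnegative second derivative and a critical zero is nonnegative. -/
lemma nonneg_of_second_deriv_nonneg {φ φ' φ'' : ℝ → ℝ}
    (h1 : ∀ t ∈ Icc (0 : ℝ) 1, HasDerivWithinAt φ (φ' t) (Icc 0 1) t)
    (h2 : ∀ t ∈ Icc (0 : ℝ) 1, HasDerivWithinAt φ' (φ'' t) (Icc 0 1) t)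
    (h : ∀ t ∈ Icc (0 : ℝ) 1, 0 ≤ φ'' t) {x : ℝ} (hx : x ∈ Icc (0 : ℝ) 1) (h0 : φ x = 0)
    (h0' : φ' x = 0) : ∀ t ∈ Icc (0 : ℝ) 1, 0 ≤ φ t := by
  have hm := monotoneOn_of_hasDerivWithinAt h2 Subset.rfl h
  intro t ht
  rcases le_total x t with hc | hc
  · have := monotoneOn_of_hasDerivWithinAt (a := x) (b := 1) h1 (Icc_subset_Icc hx.1 le_rfl)
      (fun s hs => h0' ▸ hm hx ⟨hx.1.trans hs.1, hs.2⟩ hs.1) ⟨le_rfl, hx.2⟩ ⟨hc, ht.2⟩ hc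
    rwa [h0] at this
  · have := monotoneOn_of_hasDerivWithinAt (a := 0) (b := x) (φ := fun t => -φ t)
      (φ' := fun t => -φ' t) (fun s hs => (h1 s hs).neg) (Icc_subset_Icc le_rfl hx.2)
      (fun s hs => by
        have := hm ⟨hs.1, hs.2.trans hx.2⟩ hx hs.2
        rw [h0'] at this
        linarith) ⟨ht.1, hc⟩ ⟨hx.1, le_rfl⟩ hc
    simp only [h0] at this
    linarith

lemma kantorovichDiff_le_of_deriv_le {f f' : ℝ → ℝ}
    (hf : ∀ t ∈ Icc (0 : ℝ) 1, HasDerivWithinAt f (f' t) (Icc 0 1) t) {x : ℝ}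
    (hx : x ∈ Icc (0 : ℝ) 1) {c₁ c₂ c₃ : ℝ}
    (h : ∀ t ∈ Icc (0 : ℝ) 1, f' t ≤ c₁ + 2 * c₂ * (t - x) + 3 * c₃ * (t - x) ^ 2) (m : ℕ) :
    kantorovichDiff m f x ≤ c₁ / (m + 2) + c₂ * (2 * (1 - 2 * x) / (m + 2) ^ 2)
      + c₃ * ((3 * (m - 4) * (x * (1 - x)) + 7 / 2) / (m + 2) ^ 3) := by
  rw [← kantorovichDiff_cubic]
  refine kantorovichDiff_mono (fun t ht => (hf t ht).continuousWithinAt) (by fun_prop)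
    (monotoneOn_of_hasDerivWithinAt
      (φ' := fun t => c₁ + 2 * c₂ * (t - x) + 3 * c₃ * (t - x) ^ 2 - f' t) (fun t ht => ?_)
      Subset.rfl fun t ht => sub_nonneg.2 (h t ht)) m hx
  have hy := (hasDerivWithinAt_id t (Icc (0 : ℝ) 1)).sub_const x
  refine HasDerivWithinAt.sub (((hy.const_mul c₁).add ((hy.pow 2).const_mul c₂)).add
    ((hy.pow 3).const_mul c₃) |>.congr_deriv ?_) (hf t ht)
  simp only [id]
  push_cast
  ring

lemma kantorovich_le_of_second_deriv_le {f f' f'' : ℝ → ℝ}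
    (hf : ∀ t ∈ Icc (0 : ℝ) 1, HasDerivWithinAt f (f' t) (Icc 0 1) t)
    (hf' : ∀ t ∈ Icc (0 : ℝ) 1, HasDerivWithinAt f' (f'' t) (Icc 0 1) t) {x : ℝ}
    (hx : x ∈ Icc (0 : ℝ) 1) {c₂ c₃ c₄ : ℝ}
    (h : ∀ t ∈ Icc (0 : ℝ) 1, f'' t ≤ 2 * c₂ + 6 * c₃ * (t - x) + 12 * c₄ * (t - x) ^ 2) (n : ℕ) :
    kantorovich n f x ≤ f x + f' x * ((1 - 2 * x) / 2 / (n + 1))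
      + c₂ * (((n - 1) * (x * (1 - x)) + 1 / 3) / (n + 1) ^ 2)
      + c₃ * ((1 - 2 * x) * (5 / 2 * n * (x * (1 - x)) + (1 - 2 * (x * (1 - x))) / 4)
        / (n + 1) ^ 3)
      + c₄ * ((3 * n ^ 2 * (x * (1 - x)) ^ 2 + n * (x * (1 - x)) * (5 - 20 * (x * (1 - x)))
        + 1 / 5 - x * (1 - x) + (x * (1 - x)) ^ 2) / (n + 1) ^ 4) := by
  rw [← kantorovich_quartic]
  refine kantorovich_mono (fun t ht => (hf t ht).continuousWithinAt) (by fun_prop)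
    (fun t ht => sub_nonneg.1 ?_) n hx
  refine nonneg_of_second_deriv_nonneg
    (φ := fun t => f x + f' x * (t - x) + c₂ * (t - x) ^ 2 + c₃ * (t - x) ^ 3 + c₄ * (t - x) ^ 4
      - f t)
    (φ' := fun t => f' x + 2 * c₂ * (t - x) + 3 * c₃ * (t - x) ^ 2 + 4 * c₄ * (t - x) ^ 3 - f' t)
    (φ'' := fun t => 2 * c₂ + 6 * c₃ * (t - x) + 12 * c₄ * (t - x) ^ 2 - f'' t)
    (fun t ht => ?_) (fun t ht => ?_) (fun t ht => sub_nonneg.2 (h t ht)) hx (by simp) (by simp)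
    t ht
  · have hy := (hasDerivWithinAt_id t (Icc (0 : ℝ) 1)).sub_const x
    refine HasDerivWithinAt.sub (((((hy.const_mul (f' x)).const_add (f x)).add
      ((hy.pow 2).const_mul c₂)).add ((hy.pow 3).const_mul c₃)).add ((hy.pow 4).const_mul c₄)
      |>.congr_deriv ?_) (hf t ht)
    simp only [id]
    push_cast
    ring
  · have hy := (hasDerivWithinAt_id t (Icc (0 : ℝ) 1)).sub_const x
    refine HasDerivWithinAt.sub ((((hy.const_mul (2 * c₂)).const_add (f' x)).add
      ((hy.pow 2).const_mul (3 * c₃))).add ((hy.pow 3).const_mul (4 * c₄))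
      |>.congr_deriv ?_) (hf' t ht)
    simp only [id]
    push_cast
    ring

/-! ### Quantitative estimates for the two operators -/

lemma mul_one_sub_mem {x : ℝ} (hx : x ∈ Icc (0 : ℝ) 1) : x * (1 - x) ∈ Icc (0 : ℝ) (1 / 4) :=
  ⟨mul_nonneg hx.1 (by linarith [hx.2]), by nlinarith [sq_nonneg (1 - 2 * x)]⟩

lemma abs_one_sub_two_mul_le {x : ℝ} (hx : x ∈ Icc (0 : ℝ) 1) : |1 - 2 * x| ≤ 1 :=
  abs_le.2 ⟨by linarith [hx.2], by linarith [hx.1]⟩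

lemma abs_kantorovichDiff_le {f f' : ℝ → ℝ} {F : ℝ}
    (hf : ∀ t ∈ Icc (0 : ℝ) 1, HasDerivWithinAt f (f' t) (Icc 0 1) t)
    (hF : ∀ t ∈ Icc (0 : ℝ) 1, |f' t| ≤ F) (m : ℕ) {x : ℝ} (hx : x ∈ Icc (0 : ℝ) 1) :
    |kantorovichDiff m f x| ≤ F / (m + 2) := by
  have h1 := kantorovichDiff_le_of_deriv_le hf hx (c₁ := F) (c₂ := 0) (c₃ := 0)
    (fun t ht => by linarith [(abs_le.1 (hF t ht)).2]) m
  have h2 := kantorovichDiff_le_of_deriv_le (fun t ht => (hf t ht).neg) hx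
    (c₁ := F) (c₂ := 0) (c₃ := 0) (fun t ht => by linarith [(abs_le.1 (hF t ht)).1]) m
  change kantorovichDiff m (fun t => -f t) x ≤ _ at h2
  rw [kantorovichDiff_neg] at h2
  exact abs_le.2 ⟨by linarith, by linarith⟩

/-- One-sided estimate of the approximation of the derivative by Kantorovich differences. -/
lemma mul_kantorovichDiff_sub_le {f f' : ℝ → ℝ} {η h v w : ℝ}
    (hf : ∀ t ∈ Icc (0 : ℝ) 1, HasDerivWithinAt f (f' t) (Icc 0 1) t)
    (hM : ModulusBound f' η v w) (hη : 0 < η) (hη2 : η ≤ 1 / 2) (hηh : η ≤ h) (m : ℕ)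
    (hm : (m : ℝ) + 1 ≤ (m + 2) ^ 2 * η ^ 2) {x : ℝ} (hx : x ∈ Icc (0 : ℝ) 1) :
    (m + 1) * kantorovichDiff m f x - f' x ≤ -f' x / (m + 2) + h * v + 9 / 8 * w := by
  obtain ⟨c, hc, hp⟩ := hM.exists_parabola hη hη2 hx
  have hv := hM.first_nonneg hη
  have hw := hM.second_nonneg hη
  have key := kantorovichDiff_le_of_deriv_le hf hx (c₁ := f' x + w) (c₂ := c / 2)
    (c₃ := w / (6 * η ^ 2)) (fun t ht => by
      have := hp t ht
      have e : w * (1 + (t - x) ^ 2 / (2 * η ^ 2)) = w + 3 * (w / (6 * η ^ 2)) * (t - x) ^ 2 := by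
        field_simp
        ring
      linarith) m
  obtain ⟨hX0, hX1⟩ := mul_one_sub_mem hx
  set X := x * (1 - x)
  have hm0 : (0 : ℝ) ≤ m := m.cast_nonneg
  have hN : (0 : ℝ) < (m : ℝ) + 2 := by positivity
  have key2 := mul_le_mul_of_nonneg_left key (show (0 : ℝ) ≤ (m : ℝ) + 1 by positivity)
  have b1 : ((m : ℝ) + 1) * (c / 2 * (2 * (1 - 2 * x) / (m + 2) ^ 2)) ≤ h * v := by
    have e1 : c * (1 - 2 * x) ≤ v / η := by
      refine (le_abs_self _).trans ?_
      rw [abs_mul]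
      exact (mul_le_of_le_one_right (abs_nonneg _) (abs_one_sub_two_mul_le hx)).trans hc
    calc ((m : ℝ) + 1) * (c / 2 * (2 * (1 - 2 * x) / (m + 2) ^ 2))
        = ((m : ℝ) + 1) / (m + 2) ^ 2 * (c * (1 - 2 * x)) := by field_simp
      _ ≤ ((m : ℝ) + 1) / (m + 2) ^ 2 * (v / η) := by gcongr
      _ ≤ η ^ 2 * (v / η) := by
          gcongr
          rw [div_le_iff₀ (by positivity)]
          linarith
      _ = η * v := by field_simp
      _ ≤ h * v := by gcongr
  have b2 : ((m : ℝ) + 1) * (w / (6 * η ^ 2) * ((3 * (m - 4) * X + 7 / 2) / (m + 2) ^ 3))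
      ≤ w * ((3 * (m - 4) * X + 7 / 2) / (6 * (m + 2))) := by
    -- The worst case is m = 0, X = 1/4, where the value is 1/2.
    have hA : 0 ≤ 3 * (m - 4) * X + 7 / 2 := by nlinarith
    have e1 : ((m : ℝ) + 1) / ((m + 2) ^ 2 * η ^ 2) ≤ 1 := by
      rw [div_le_one (by positivity)]
      exact hm
    calc ((m : ℝ) + 1) * (w / (6 * η ^ 2) * ((3 * (m - 4) * X + 7 / 2) / (m + 2) ^ 3))
        = ((m : ℝ) + 1) / ((m + 2) ^ 2 * η ^ 2)
            * (w * ((3 * (m - 4) * X + 7 / 2) / (6 * (m + 2)))) := by field_simp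
      _ ≤ 1 * (w * ((3 * (m - 4) * X + 7 / 2) / (6 * (m + 2)))) := by gcongr
      _ = _ := one_mul _
  have b3 : ((m : ℝ) + 1) / (m + 2) * w + w * ((3 * (m - 4) * X + 7 / 2) / (6 * (m + 2)))
      ≤ 9 / 8 * w := by
    -- As m grows with X = 1/4, the constant part tends to 1 and the quadratic part to 1/8: hence
    -- 9/8.
    have : ((m : ℝ) + 1) / (m + 2) + (3 * (m - 4) * X + 7 / 2) / (6 * (m + 2)) ≤ 9 / 8 := by
      rw [div_add_div _ _ hN.ne' (by positivity), div_le_iff₀ (by positivity)]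
      nlinarith [mul_nonneg hm0 (sub_nonneg.2 hX1)]
    nlinarith
  have e : ((m : ℝ) + 1) * ((f' x + w) / (m + 2)) - f' x =
      -f' x / (m + 2) + ((m : ℝ) + 1) / (m + 2) * w := by
    field_simp
    ring
  linarith

lemma abs_mul_kantorovichDiff_sub_le {f f' : ℝ → ℝ} {η h v w F : ℝ}
    (hf : ∀ t ∈ Icc (0 : ℝ) 1, HasDerivWithinAt f (f' t) (Icc 0 1) t)
    (hM : ModulusBound f' η v w) (hη : 0 < η) (hη2 : η ≤ 1 / 2) (hηh : η ≤ h) (m : ℕ)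
    (hm : (m : ℝ) + 1 ≤ (m + 2) ^ 2 * η ^ 2) {x : ℝ} (hx : x ∈ Icc (0 : ℝ) 1) (hF : |f' x| ≤ F) :
    |(m + 1) * kantorovichDiff m f x - f' x| ≤ 1 / (m + 2) * F + h * v + 9 / 8 * w := by
  have h1 := mul_kantorovichDiff_sub_le hf hM hη hη2 hηh m hm hx
  have h2 := mul_kantorovichDiff_sub_le (fun t ht => (hf t ht).neg) hM.neg hη hη2 hηh m hm hx
  change _ * kantorovichDiff m (fun t => -f t) x - -f' x ≤ _ at h2
  rw [kantorovichDiff_neg] at h2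
  have h3 : |f' x / (m + 2)| ≤ 1 / (m + 2) * F := by
    rw [abs_div, abs_of_pos (show (0 : ℝ) < m + 2 by positivity), div_eq_inv_mul, one_div]
    gcongr
  have h4 := abs_le.1 h3
  have e : - -f' x / ((m : ℝ) + 2) = f' x / (m + 2) := by ring
  have e' : -f' x / ((m : ℝ) + 2) = -(f' x / (m + 2)) := by ring
  rw [e] at h2
  rw [e'] at h1
  exact abs_le.2 ⟨by linarith, by linarith⟩

lemma fourth_moment_bounds {n X : ℝ} (hn : 1 ≤ n) (hX0 : 0 ≤ X) (hX1 : X ≤ 1 / 4) :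
    0 ≤ 3 * n ^ 2 * X ^ 2 + n * X * (5 - 20 * X) + 1 / 5 - X + X ^ 2 ∧
      (3 * n ^ 2 * X ^ 2 + n * X * (5 - 20 * X) + 1 / 5 - X + X ^ 2) / (24 * (n + 1) ^ 2)
        ≤ 1 / 8 := by
  have h0 : 0 ≤ n * X * (5 - 20 * X) := mul_nonneg (by positivity) (by linarith)
  have h1 : X ^ 2 ≤ 1 / 16 := by nlinarith
  have h2 : n ^ 2 * X ^ 2 ≤ n ^ 2 * (1 / 16) := by gcongr
  have h3 : X ^ 2 ≤ n ^ 2 * X ^ 2 := le_mul_of_one_le_left (by positivity) (by nlinarith)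
  have h4 : n * X * (5 - 20 * X) ≤ n * (1 / 4) * 5 := by
    gcongr <;> linarith
  constructor
  · nlinarith [sq_nonneg (X - 1 / 8)]
  · rw [div_le_iff₀ (by positivity)]
    nlinarith

/-- One-sided quantitative Voronovskaya estimate for the Kantorovich operator. -/
lemma kantorovich_voronovskaya_le {f f' f'' : ℝ → ℝ} {η h v w F G : ℝ}
    (hf : ∀ t ∈ Icc (0 : ℝ) 1, HasDerivWithinAt f (f' t) (Icc 0 1) t)
    (hf' : ∀ t ∈ Icc (0 : ℝ) 1, HasDerivWithinAt f' (f'' t) (Icc 0 1) t)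
    (hM : ModulusBound f'' η v w) (hη : 0 < η) (hη2 : η ≤ 1 / 2) (hηh : η ≤ h) (n : ℕ)
    (hn1 : 1 ≤ n) (hn : (n : ℝ) ≤ (n + 1) ^ 2 * η ^ 2) {x : ℝ} (hx : x ∈ Icc (0 : ℝ) 1)
    (hF : |f' x| ≤ F) (hG : |f'' x| ≤ G) :
    n * (kantorovich n f x - f x) - x * (1 - x) / 2 * f'' x - (1 - 2 * x) / 2 * f' x ≤
      2 / (3 * (n + 1)) * (3 / 4 * F + G) + 9 / 32 * (2 * h * v + w) := by
  obtain ⟨c, hc, hp⟩ := hM.exists_parabola hη hη2 hx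
  have hv := hM.first_nonneg hη
  have hw := hM.second_nonneg hη
  have key := kantorovich_le_of_second_deriv_le hf hf' hx (c₂ := (f'' x + w) / 2) (c₃ := c / 6)
    (c₄ := w / (24 * η ^ 2)) (fun t ht => by
      have := hp t ht
      have e : w * (1 + (t - x) ^ 2 / (2 * η ^ 2)) = w + 12 * (w / (24 * η ^ 2)) * (t - x) ^ 2 := by
        field_simp
        ring
      linarith) n
  obtain ⟨hX0, hX1⟩ := mul_one_sub_mem hx
  set X := x * (1 - x)
  have hX' := abs_one_sub_two_mul_le hx
  have hn1' : (1 : ℝ) ≤ n := by exact_mod_cast hn1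
  have hN : (0 : ℝ) < (n : ℝ) + 1 := by positivity
  have key2 := mul_le_mul_of_nonneg_left key (show (0 : ℝ) ≤ (n : ℝ) by positivity)
  have hq : (n : ℝ) / ((n + 1) ^ 2) ≤ η ^ 2 := by
    rw [div_le_iff₀ (by positivity)]
    linarith
  have b1 : (n : ℝ) * (c / 6 * ((1 - 2 * x) * (5 / 2 * n * X + (1 - 2 * X) / 4) / (n + 1) ^ 3))
      ≤ 9 / 32 * (2 * h * v) := by
    have e0 : |c * (1 - 2 * x)| ≤ v / η := by
      rw [abs_mul]
      exact (mul_le_of_le_one_right (abs_nonneg _) hX').trans hc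
    have e1 : c * (1 - 2 * x) ≤ v / η := (le_abs_self _).trans e0
    have hA : 0 ≤ (5 / 2 * n * X + (1 - 2 * X) / 4) / (6 * (n + 1)) :=
      div_nonneg (add_nonneg (by positivity) (by linarith)) (by positivity)
    have hA1 : (5 / 2 * n * X + (1 - 2 * X) / 4) / (6 * (n + 1)) ≤ 9 / 16 := by
      rw [div_le_iff₀ (by positivity)]
      nlinarith [mul_le_mul_of_nonneg_left hX1 (show (0 : ℝ) ≤ n by positivity)]
    calc (n : ℝ) * (c / 6 * ((1 - 2 * x) * (5 / 2 * n * X + (1 - 2 * X) / 4) / (n + 1) ^ 3))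
        = (n : ℝ) / (n + 1) ^ 2 * (c * (1 - 2 * x))
          * ((5 / 2 * n * X + (1 - 2 * X) / 4) / (6 * (n + 1))) := by field_simp
      _ ≤ (n : ℝ) / (n + 1) ^ 2 * (v / η)
          * ((5 / 2 * n * X + (1 - 2 * X) / 4) / (6 * (n + 1))) := by gcongr
      _ ≤ η ^ 2 * (v / η) * (9 / 16) := by gcongr
      _ = 9 / 16 * (η * v) := by field_simp
      _ ≤ 9 / 16 * (h * v) := by gcongr
      _ = _ := by ring
  have b2 : (n : ℝ) * (w / (24 * η ^ 2) * ((3 * n ^ 2 * X ^ 2 + n * X * (5 - 20 * X) + 1 / 5 - X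
      + X ^ 2) / (n + 1) ^ 4)) ≤ 1 / 8 * w := by
    obtain ⟨hA, hA1⟩ := fourth_moment_bounds hn1' hX0 hX1
    have e1 : (n : ℝ) / ((n + 1) ^ 2 * η ^ 2) ≤ 1 := by
      rw [div_le_one (by positivity)]
      exact hn
    calc (n : ℝ) * (w / (24 * η ^ 2) * ((3 * n ^ 2 * X ^ 2 + n * X * (5 - 20 * X) + 1 / 5 - X
          + X ^ 2) / (n + 1) ^ 4))
        = (n : ℝ) / ((n + 1) ^ 2 * η ^ 2) * ((3 * n ^ 2 * X ^ 2 + n * X * (5 - 20 * X) + 1 / 5 - X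
          + X ^ 2) / (24 * (n + 1) ^ 2)) * w := by field_simp
      _ ≤ 1 * (1 / 8) * w := by gcongr
      _ = _ := by ring
  -- The limit at X = 1/4 is 1/8. With the 1/8 from `b2` the total weight of `w` is 1/4, below 9/32.
  have b3 : (n : ℝ) * (w / 2 * (((n - 1) * X + 1 / 3) / (n + 1) ^ 2)) ≤ 1 / 8 * w := by
    have : (n : ℝ) / 2 * (((n - 1) * X + 1 / 3) / (n + 1) ^ 2) ≤ 1 / 8 := by
      have h1 : ((n : ℝ) - 1) * X + 1 / 3 ≤ (n - 1) * (1 / 4) + 1 / 3 := by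
        gcongr
      have h2 := mul_le_mul_of_nonneg_left h1 (show (0 : ℝ) ≤ n by positivity)
      rw [div_mul_div_comm, div_le_iff₀ (by positivity)]
      linarith
    calc (n : ℝ) * (w / 2 * (((n - 1) * X + 1 / 3) / (n + 1) ^ 2))
        = (n : ℝ) / 2 * (((n - 1) * X + 1 / 3) / (n + 1) ^ 2) * w := by ring
      _ ≤ 1 / 8 * w := by gcongr
  have b4 : (n : ℝ) * (f' x * ((1 - 2 * x) / 2 / (n + 1))) - (1 - 2 * x) / 2 * f' x ≤
      1 / (2 * (n + 1)) * F := by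
    have e : (n : ℝ) * (f' x * ((1 - 2 * x) / 2 / (n + 1))) - (1 - 2 * x) / 2 * f' x =
        1 / (2 * (n + 1)) * (-(f' x * (1 - 2 * x))) := by
      field_simp
      ring
    rw [e]
    gcongr
    refine (neg_le_abs _).trans ?_
    rw [abs_mul]
    exact (mul_le_of_le_one_right (abs_nonneg _) hX').trans hF
  -- The second moment misses X/n by a relative O(1/n); the bound obtained has 1/2 in place of 2/3.
  have b5 : (n : ℝ) * (f'' x / 2 * (((n - 1) * X + 1 / 3) / (n + 1) ^ 2)) - X / 2 * f'' x ≤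
      2 / (3 * (n + 1)) * G := by
    have e : (n : ℝ) * (f'' x / 2 * (((n - 1) * X + 1 / 3) / (n + 1) ^ 2)) - X / 2 * f'' x =
        f'' x * ((n / 3 - (3 * n + 1) * X) / (2 * (n + 1) ^ 2)) := by
      field_simp
      ring
    have hq : |((n : ℝ) / 3 - (3 * n + 1) * X) / (2 * ((n : ℝ) + 1) ^ 2)| ≤
        2 / (3 * ((n : ℝ) + 1)) := by
      have h1 : |(n : ℝ) / 3 - (3 * n + 1) * X| ≤ (n : ℝ) + 1 := by
        rw [abs_le]
        constructor <;> nlinarith [mul_nonneg (show (0 : ℝ) ≤ n by positivity) hX0,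
          mul_le_mul_of_nonneg_left hX1 (show (0 : ℝ) ≤ n by positivity)]
      rw [abs_div, abs_of_pos (show (0 : ℝ) < 2 * ((n : ℝ) + 1) ^ 2 by positivity)]
      calc |(n : ℝ) / 3 - (3 * n + 1) * X| / (2 * ((n : ℝ) + 1) ^ 2)
          ≤ ((n : ℝ) + 1) / (2 * ((n : ℝ) + 1) ^ 2) := by gcongr
        _ = 1 / 2 / ((n : ℝ) + 1) := by field_simp
        _ ≤ 2 / 3 / ((n : ℝ) + 1) := by gcongr ?_ / _; norm_num
        _ = 2 / (3 * (n + 1)) := by field_simp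
    rw [e]
    refine (le_abs_self _).trans ?_
    rw [abs_mul, mul_comm]
    gcongr
  have e1 : 2 / (3 * ((n : ℝ) + 1)) * (3 / 4 * F + G) =
      1 / (2 * (n + 1)) * F + 2 / (3 * (n + 1)) * G := by
    field_simp
    ring
  rw [e1]
  linarith

lemma abs_kantorovich_voronovskaya_le {f f' f'' : ℝ → ℝ} {η h v w F G : ℝ}
    (hf : ∀ t ∈ Icc (0 : ℝ) 1, HasDerivWithinAt f (f' t) (Icc 0 1) t)
    (hf' : ∀ t ∈ Icc (0 : ℝ) 1, HasDerivWithinAt f' (f'' t) (Icc 0 1) t)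
    (hM : ModulusBound f'' η v w) (hη : 0 < η) (hη2 : η ≤ 1 / 2) (hηh : η ≤ h) (n : ℕ)
    (hn1 : 1 ≤ n) (hn : (n : ℝ) ≤ (n + 1) ^ 2 * η ^ 2) {x : ℝ} (hx : x ∈ Icc (0 : ℝ) 1)
    (hF : |f' x| ≤ F) (hG : |f'' x| ≤ G) :
    |n * (kantorovich n f x - f x) - x * (1 - x) / 2 * f'' x - (1 - 2 * x) / 2 * f' x| ≤
      2 / (3 * (n + 1)) * (3 / 4 * F + G) + 9 / 32 * (2 * h * v + w) := by
  have h1 := kantorovich_voronovskaya_le hf hf' hM hη hη2 hηh n hn1 hn hx hF hG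
  have h2 := kantorovich_voronovskaya_le (f := fun t => -f t) (f' := fun t => -f' t) (F := F)
    (G := G) (fun t ht => (hf t ht).neg) (fun t ht => (hf' t ht).neg)
    hM.neg hη hη2 hηh n hn1 hn hx (by rwa [abs_neg]) (by rwa [abs_neg])
  rw [kantorovich_neg] at h2
  exact abs_le.2 ⟨by linarith, by linarith⟩

/-! ### Moduli of smoothness and choice of the step -/

lemma abs_le_supNorm {g : ℝ → ℝ} (hg : ContinuousOn g (Icc 0 1)) {t : ℝ}
    (ht : t ∈ Icc (0 : ℝ) 1) : |g t| ≤ supNorm g :=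
  le_csSup (isCompact_Icc.bddAbove_image hg.abs) ⟨t, ht, rfl⟩

lemma modulusBound_omega {g : ℝ → ℝ} (hg : ContinuousOn g (Icc 0 1)) {η h : ℝ} (hηh : η ≤ h) :
    ModulusBound g η (omega1 g h) (omega2 g h) where
  cont := hg
  first s hs t ht hst := by
    refine le_csSup ⟨2 * supNorm g, ?_⟩ ⟨s, hs, t, ht, hst.trans hηh, rfl⟩
    rintro r ⟨a, ha, b, hb, -, rfl⟩
    linarith [abs_sub (g a) (g b), abs_le_supNorm hg ha, abs_le_supNorm hg hb]
  second s d h0 h1 h2 h3 := by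
    refine le_csSup ⟨4 * supNorm g, ?_⟩ ⟨s, d, h0, h1.trans hηh, h2, h3, rfl⟩
    rintro r ⟨a, e, he, -, ha, hb, rfl⟩
    have k1 := abs_le.1 (abs_le_supNorm hg (t := a + e) ⟨by linarith, hb⟩)
    have k2 := abs_le.1 (abs_le_supNorm hg (t := a) ⟨by linarith, by linarith⟩)
    have k3 := abs_le.1 (abs_le_supNorm hg (t := a - e) ⟨ha, by linarith⟩)
    exact abs_le.2 ⟨by linarith, by linarith⟩

/-- The step at which the parabola estimate is applied. -/
lemma exists_step (n : ℕ) (hn : 1 ≤ n) :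
    ∃ η : ℝ, 0 < η ∧ η ≤ 1 / 2 ∧ η ≤ 1 / √((n : ℝ) + 1) ∧ (n : ℝ) ≤ (n + 1) ^ 2 * η ^ 2 := by
  -- For n = 1, 2 the natural step 1/√(n+1) exceeds 1/2, so 1/2 is used; it is still large enough
  -- for the moment bounds.
  rcases Nat.lt_or_ge n 3 with h | h
  · refine ⟨1 / 2, by norm_num, le_rfl, ?_, ?_⟩
    · refine one_div_le_one_div_of_le (by positivity) ?_
      rw [Real.sqrt_le_left (by norm_num)]
      have : (n : ℝ) ≤ 2 := by exact_mod_cast Nat.lt_succ_iff.1 h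
      linarith
    · interval_cases n <;> norm_num
  · have h3 : (3 : ℝ) ≤ n := by exact_mod_cast h
    refine ⟨1 / √((n : ℝ) + 1), by positivity, ?_, le_rfl, ?_⟩
    · refine one_div_le_one_div_of_le (by norm_num) ?_
      rw [Real.le_sqrt (by norm_num) (by positivity)]
      linarith
    · rw [div_pow, Real.sq_sqrt (by positivity)]
      field_simp
      linarith

end KantorovichModified

end

/-! ### Assembly of the final estimate -/

theorem mainTheorem6 (a₀ a₁ : ℕ → ℝ) (ha : ∀ n : ℕ, 1 ≤ n → 2 * a₀ n + a₁ n = 1)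
    (L₁ : ℝ) (hL : Tendsto a₁ atTop (𝓝 L₁))
    (f : ℝ → ℝ) (hf : ContDiffOn ℝ 2 f (Icc 0 1))
    (n : ℕ) (hn : 1 ≤ n) (x : ℝ) (hx : x ∈ Icc (0 : ℝ) 1) :
    KantorovichModified.voronovskayaDefect a₀ a₁ L₁ n f x ≤
      2 / (3 * ((n : ℝ) + 1)) *
          (3 / 4 * KantorovichModified.supNorm (KantorovichModified.unitDeriv f)
            + KantorovichModified.supNorm
                (KantorovichModified.unitDeriv (KantorovichModified.unitDeriv f)))
        + 9 / 32 *
          (2 / √((n : ℝ) + 1) * KantorovichModified.omega1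
                (KantorovichModified.unitDeriv (KantorovichModified.unitDeriv f))
                (1 / √((n : ℝ) + 1))
            + KantorovichModified.omega2
                (KantorovichModified.unitDeriv (KantorovichModified.unitDeriv f))
                (1 / √((n : ℝ) + 1)))
        + 1 / 2 * |L₁ - a₁ n| * KantorovichModified.supNorm (KantorovichModified.unitDeriv f)
        + 1 / 2 * |L₁ + 1| *
          (1 / ((n : ℝ) + 1) * KantorovichModified.supNorm (KantorovichModified.unitDeriv f)
            + 1 / √((n : ℝ) + 1) * KantorovichModified.omega1
                (KantorovichModified.unitDeriv f) (1 / √((n : ℝ) + 1))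
            + 9 / 8 * KantorovichModified.omega2
                (KantorovichModified.unitDeriv f) (1 / √((n : ℝ) + 1))) := by
  open KantorovichModified in
  have hU : UniqueDiffOn ℝ (Icc (0 : ℝ) 1) := uniqueDiffOn_Icc_zero_one
  have hf1 : ContDiffOn ℝ 1 (unitDeriv f) (Icc 0 1) := hf.derivWithin hU (by norm_num)
  have hc1 : ContinuousOn (unitDeriv f) (Icc 0 1) := hf1.continuousOn
  have hc2 : ContinuousOn (unitDeriv (unitDeriv f)) (Icc 0 1) :=
    hf1.continuousOn_derivWithin hU le_rfl
  have hd1 : ∀ t ∈ Icc (0 : ℝ) 1, HasDerivWithinAt f (unitDeriv f t) (Icc 0 1) t := fun t ht =>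
    (hf.differentiableOn (by norm_num) t ht).hasDerivWithinAt
  have hd2 : ∀ t ∈ Icc (0 : ℝ) 1,
      HasDerivWithinAt (unitDeriv f) (unitDeriv (unitDeriv f) t) (Icc 0 1) t := fun t ht =>
    (hf1.differentiableOn (by norm_num) t ht).hasDerivWithinAt
  obtain ⟨η, hη, hη2, hηh, hnη⟩ := exists_step n hn
  have kV := abs_kantorovich_voronovskaya_le hd1 hd2 (modulusBound_omega hc2 hηh) hη hη2 hηh n hn
    hnη hx (abs_le_supNorm hc1 hx) (abs_le_supNorm hc2 hx)
  obtain ⟨m, rfl⟩ : ∃ m, n = m + 1 := ⟨n - 1, by omega⟩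
  have eN : ((m + 1 : ℕ) : ℝ) + 1 = m + 2 := by push_cast; ring
  have en : ((m + 1 : ℕ) : ℝ) = m + 1 := by push_cast; ring
  rw [eN, en] at hnη
  have kD := abs_mul_kantorovichDiff_sub_le hd1 (modulusBound_omega hc1 hηh) hη hη2 hηh m
    hnη hx (abs_le_supNorm hc1 hx)
  have kB := abs_kantorovichDiff_le hd1 (fun t ht => abs_le_supNorm hc1 ht) m hx
  rw [voronovskayaDefect, modKantorovich_succ a₀ a₁ m f x (ha _ hn)]
  rw [eN] at kV kD ⊢
  rw [en] at kV ⊢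
  set F := supNorm (unitDeriv f)
  set D := kantorovichDiff m f x
  set K := kantorovich (m + 1) f x
  have hX' := abs_one_sub_two_mul_le hx
  have hF0 : 0 ≤ F := (abs_nonneg _).trans (abs_le_supNorm hc1 hx)
  have kB' : |((m : ℝ) + 1) * D| ≤ F := by
    rw [abs_mul, abs_of_pos (show (0 : ℝ) < m + 1 by positivity)]
    calc ((m : ℝ) + 1) * |D| ≤ (m + 1) * (F / (m + 2)) := by gcongr
      _ = (m + 1) / (m + 2) * F := by ring
      _ ≤ 1 * F := by
          gcongr
          rw [div_le_one (by positivity)]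
          linarith
      _ = F := one_mul F
  -- Split (a₁+1)nD - (L₁+1)f' as (a₁-L₁)nD + (L₁+1)(nD-f'), with n = m + 1; the remaining f'
  -- belongs to the classical defect.
  have e : ((m : ℝ) + 1) * (K + (a₁ (m + 1) + 1) * (1 - 2 * x) / 2 * D - f x)
      - x * (1 - x) / 2 * unitDeriv (unitDeriv f) x - (1 - 2 * x) / 2 * (2 + L₁) * unitDeriv f x =
      ((m + 1) * (K - f x) - x * (1 - x) / 2 * unitDeriv (unitDeriv f) x
        - (1 - 2 * x) / 2 * unitDeriv f x)
      + (1 - 2 * x) * (1 / 2 * (a₁ (m + 1) - L₁) * ((m + 1) * D))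
      + (1 - 2 * x) * (1 / 2 * (L₁ + 1) * ((m + 1) * D - unitDeriv f x)) := by ring
  rw [e]
  have half : |(1 / 2 : ℝ)| = 1 / 2 := abs_of_pos (by norm_num)
  refine (abs_add_three _ _ _).trans (add_le_add (add_le_add (kV.trans_eq ?_) ?_) ?_)
  · ring
  · rw [abs_mul]
    refine (mul_le_of_le_one_left (abs_nonneg _) hX').trans ?_
    rw [abs_mul, abs_mul, half, abs_sub_comm]
    gcongr
  · rw [abs_mul]
    refine (mul_le_of_le_one_left (abs_nonneg _) hX').trans ?_
    rw [abs_mul, abs_mul, half]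
    gcongr
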